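/- **Theorem.** Let $n_1,n_2\ge 2$ be integers, $p>0$, $\sigma>0$, and let $s$ be an integer with $1\le s\le n_2/2$. One observes $Y=A+E$, where $A\in\mathbb R^{n_1\times n_2}$ is unknown and the entries $\xi_{ij}$ of $E$ are i.i.d. $\mathcal N(0,\sigma^2)$. Write $\|A\|_{2,p}=\big(\sum_{i=1}^{n_1}\|A_{i\cdot}\|_2^p\big)^{1/p}$, where $\|A_{i\cdot}\|_2$ is the Euclidean norm of the $i$-th row of $A$, and let $\mathcal A(s)$ be the set of all $A\in\mathbb R^{n_1\times n_2}$ each of whose rows has at most $s$ nonzero entries. Then (i) $$\inf_{\hat A}\ \sup_{A\in\mathcal A(s)}\ \mathbb P\Big\{\|\hat A-A\|_{2,p}^2\ \ge\ C\,\sigma^2\,n_1^{2/p}\,s\,\log\Big(\frac{e\,n_2}{s}\Big)\Big\}\ \ge\ \beta;$$ (ii) $$\inf_{\hat A}\ \sup_{A\in\mathcal A(s)}\ \mathbb E\,\|\hat A-A\|_{2,p}^2\ \ge\ \tilde C\,\sigma^2\,n_1^{2/p}\,s\,\log\Big(\frac{e\,n_2}{s}\Big).$$ Here the infima are over all estimators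 $\hat A=\hat A(Y)$, that is, all measurable functions of the observation $Y$ with values in $\mathbb R^{n_1\times n_2}$, and $0<\beta<1$, $C>0$, $\tilde C>0$ are absolute constants (they do not depend on $n_1,n_2,s,p,\sigma$). -/

import Mathlib

open MeasureTheory ProbabilityTheory
open scoped ENNReal

noncomputable section

/-- The mixed (quasi-)norm `‖A‖_{2,p} = (∑ᵢ ‖A_{i·}‖₂ ^ p) ^ (1/p)` of a real matrix, where
`‖A_{i·}‖₂` is the Euclidean norm of the `i`-th row. -/
def mixedNorm {n₁ n₂ : ℕ} (p : ℝ) (A : Matrix (Fin n₁) (Fin n₂) ℝ) : ℝ :=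
  (∑ i, ‖WithLp.toLp 2 (A.row i)‖ ^ p) ^ (1 / p)

/-- The vectors of `ℝⁿ` with at most `s` nonzero entries. -/
def sparseBall (n s : ℕ) : Set (Fin n → ℝ) :=
  {v | hammingNorm v ≤ s}

/-- The hard row-sparsity class `𝒜(s)`: every row has at most `s` nonzero entries. -/
def rowSparse (n₁ n₂ s : ℕ) : Set (Matrix (Fin n₁) (Fin n₂) ℝ) :=
  {A | ∀ i, A.row i ∈ sparseBall n₂ s}

/-- The Borel (product) σ-algebra on real `n₁ × n₂` matrices. -/
instance matrixMeasurableSpace (n₁ n₂ : ℕ) : MeasurableSpace (Matrix (Fin n₁) (Fin n₂) ℝ) :=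
  inferInstanceAs (MeasurableSpace (Fin n₁ → Fin n₂ → ℝ))

/-- An estimator: a Borel measurable map from the observed matrix to `n₁ × n₂` matrices. -/
def Estimator (n₁ n₂ : ℕ) : Type :=
  {f : Matrix (Fin n₁) (Fin n₂) ℝ → Matrix (Fin n₁) (Fin n₂) ℝ // Measurable f}

/-- The noise variables `ξ i j` are independent and each has the law `N(0, σ²)`. -/
structure IsGaussianNoise {Ω : Type*} [MeasurableSpace Ω] (P : Measure Ω) {n₁ n₂ : ℕ} (σ : ℝ)
    (ξ : Fin n₁ → Fin n₂ → Ω → ℝ) : Prop where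
  hasLaw : ∀ i j, HasLaw (ξ i j) (gaussianReal 0 (σ ^ 2).toNNReal) P
  indep : iIndepFun (fun ij : Fin n₁ × Fin n₂ => ξ ij.1 ij.2) P

/-- The observation `Y = A + E`, where `E` is the noise matrix with entries `ξ i j`. -/
def observation {Ω : Type*} {n₁ n₂ : ℕ} (ξ : Fin n₁ → Fin n₂ → Ω → ℝ)
    (A : Matrix (Fin n₁) (Fin n₂) ℝ) (ω : Ω) : Matrix (Fin n₁) (Fin n₂) ℝ :=
  A + Matrix.of fun i j => ξ i j ω

/-- The squared error `‖Â(Y) - A‖²_{2,p}`, as a random variable. -/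
def sqError {Ω : Type*} {n₁ n₂ : ℕ} (p : ℝ) (ξ : Fin n₁ → Fin n₂ → Ω → ℝ)
    (est : Estimator n₁ n₂) (A : Matrix (Fin n₁) (Fin n₂) ℝ) (ω : Ω) : ℝ :=
  mixedNorm p (est.1 (observation ξ A ω) - A) ^ 2

/-- The rate `σ² n₁^{2/p} s log(e n₂ / s)`. -/
def lowerRate (n₁ n₂ s : ℕ) (p σ : ℝ) : ℝ :=
  σ ^ 2 * (n₁ : ℝ) ^ (2 / p) * s * Real.log (Real.exp 1 * n₂ / s)

end

/-! The supremum over `A` dominates an average over a prior with independent rows. In each row, `s`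
disjoint blocks of length `m = n₂ / s` carry one spike each, at a uniform position and with height
`τ (1 + u)`, `u` uniform on `[0, 1]`. The random height makes arbitrarily accurate estimation
unlikely, not merely exact recovery of the support.

In one row, Cauchy–Schwarz compares the joint law of parameter and data with the law in which the
data are pure noise independent of the parameter (`sq_measure_gaussian_location_le`). The price is
`E exp(‖a‖² / v) ≤ exp(4τ² / v) ^ s`. Under pure noise the estimate is a guess, controlled by the
small-ball bound `blockPrior_small_ball`. With `τ² ≍ σ² log(e n₂ / s)` the factor `m` gained by
guessing positions pays the price, and the row error falls below `c / 256 ^ l` with probability at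
most `2 ^ (-l)` (`row_estimation_error_prob`).

Constants uniform in `p`, even as `p → 0`, call for control of the geometric mean of the row errors.
`scaleCount` serves as a discrete `log (c / d)`. Its mean is at most 2 per row, so by Markov its sum
over rows is below `4 n₁` with probability at least 1/2, and convexity of `exp` turns this into a
bound on the mixed norm for every `p > 0` (`mixedNorm_sq_ge_of_scaleCount`). -/

/-! ### Gaussian shifts and change of measure -/

theorem lintegral_pi_prod {ι : Type*} [Fintype ι] {X : ι → Type*} [∀ i, MeasurableSpace (X i)]
    (μ : ∀ i, Measure (X i)) [∀ i, IsProbabilityMeasure (μ i)] {f : ∀ i, X i → ℝ≥0∞}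
    (hf : ∀ i, Measurable (f i)) :
    ∫⁻ x, ∏ i, f i (x i) ∂Measure.pi μ = ∏ i, ∫⁻ x, f i x ∂μ i := by
  rw [lintegral_prod_eq_prod_lintegral_of_indepFun Finset.univ (fun i (x : ∀ i, X i) => f i (x i))
    (iIndepFun_pi fun i => (hf i).aemeasurable) fun i => (hf i).comp (measurable_pi_apply i)]
  refine Finset.prod_congr rfl fun i _ => ?_
  exact (measurePreserving_eval μ i).lintegral_comp (hf i)

theorem pi_withDensity_eq {ι : Type*} [Fintype ι] {X : ι → Type*} [∀ i, MeasurableSpace (X i)]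
    (μ : ∀ i, Measure (X i)) [∀ i, IsProbabilityMeasure (μ i)] {f : ∀ i, X i → ℝ≥0∞}
    (hf : ∀ i, Measurable (f i)) [∀ i, SigmaFinite ((μ i).withDensity (f i))] :
    Measure.pi (fun i => (μ i).withDensity (f i)) =
      (Measure.pi μ).withDensity fun x => ∏ i, f i (x i) := by
  classical
  refine Measure.pi_eq fun s hs => ?_
  rw [withDensity_apply _ (MeasurableSet.univ_pi hs), ← lintegral_indicator
    (MeasurableSet.univ_pi hs)]
  have : ∀ x : ∀ i, X i, (Set.univ.pi s).indicator (fun x => ∏ i, f i (x i)) x =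
      ∏ i, (s i).indicator (f i) (x i) := by
    intro x
    by_cases hx : x ∈ Set.univ.pi s
    · rw [Set.indicator_of_mem hx]
      exact Finset.prod_congr rfl fun i _ => (Set.indicator_of_mem (hx i trivial) _).symm
    · rw [Set.indicator_of_notMem hx]
      simp only [Set.mem_univ_pi, not_forall] at hx
      obtain ⟨i, hi⟩ := hx
      exact (Finset.prod_eq_zero (Finset.mem_univ i) (Set.indicator_of_notMem hi _)).symm
  simp_rw [this]
  rw [lintegral_pi_prod μ fun i => (hf i).indicator (hs i)]
  refine Finset.prod_congr rfl fun i _ => ?_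
  rw [withDensity_apply _ (hs i), lintegral_indicator (hs i)]

/-- The density of `N(a, v)` with respect to `N(0, v)`. -/
noncomputable def gaussianShift (v : NNReal) (a y : ℝ) : ℝ≥0∞ :=
  ENNReal.ofReal (Real.exp ((a * y - a ^ 2 / 2) / v))

theorem measurable_gaussianShift (v : NNReal) (a : ℝ) : Measurable (gaussianShift v a) := by
  unfold gaussianShift; fun_prop

theorem gaussianReal_withDensity_shift {v : NNReal} (hv : v ≠ 0) (a : ℝ) :
    (gaussianReal 0 v).withDensity (gaussianShift v a) = gaussianReal a v := by
  rw [gaussianReal_of_var_ne_zero _ hv, gaussianReal_of_var_ne_zero _ hv,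
    ← withDensity_mul _ (measurable_gaussianPDF _ _) (measurable_gaussianShift v a)]
  congr 1
  ext y
  have hv' : (v : ℝ) ≠ 0 := by exact_mod_cast hv
  simp only [Pi.mul_apply, gaussianPDF, gaussianShift, gaussianPDFReal]
  rw [← ENNReal.ofReal_mul (by positivity), mul_assoc, ← Real.exp_add]
  congr 3
  field_simp
  ring

/-- Completing the square: the squared density of a shift by `a` is `exp(a² / v)` times the density
of a shift by `2a`, which integrates to 1. -/
theorem lintegral_gaussianShift_sq {v : NNReal} (hv : v ≠ 0) (a : ℝ) :
    ∫⁻ y, gaussianShift v a y ^ 2 ∂gaussianReal 0 v = ENNReal.ofReal (Real.exp (a ^ 2 / v)) := by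
  have h : ∀ y, gaussianShift v a y ^ 2 =
      ENNReal.ofReal (Real.exp (a ^ 2 / v)) * gaussianShift v (2 * a) y := by
    intro y
    simp only [gaussianShift]
    rw [← ENNReal.ofReal_pow (by positivity), ← ENNReal.ofReal_mul (by positivity), ← Real.exp_add,
      ← Real.exp_nat_mul]
    congr 2
    push_cast
    ring
  simp_rw [h]
  rw [lintegral_const_mul _ (measurable_gaussianShift v _), ← setLIntegral_univ,
    ← withDensity_apply _ MeasurableSet.univ, gaussianReal_withDensity_shift hv]
  simp

theorem pi_gaussian_withDensity_shift {ι : Type*} [Fintype ι] {v : NNReal} (hv : v ≠ 0)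
    (a : ι → ℝ) :
    (Measure.pi fun _ : ι => gaussianReal 0 v).withDensity (fun y => ∏ i, gaussianShift v (a i) (y i))
      = Measure.pi fun i => gaussianReal (a i) v := by
  have h := fun i => gaussianReal_withDensity_shift hv (a i)
  have : ∀ i, SigmaFinite ((gaussianReal 0 v).withDensity (gaussianShift v (a i))) := by
    intro i; rw [h]; infer_instance
  rw [← pi_withDensity_eq (fun _ : ι => gaussianReal 0 v)
    (fun i => measurable_gaussianShift v (a i))]
  simp_rw [h]

theorem lintegral_pi_gaussian_add {ι : Type*} [Fintype ι] {v : NNReal} (hv : v ≠ 0)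
    (a : ι → ℝ) {f : (ι → ℝ) → ℝ≥0∞} (hf : Measurable f) :
    ∫⁻ e, f (a + e) ∂Measure.pi (fun _ : ι => gaussianReal 0 v) =
      ∫⁻ y, (∏ i, gaussianShift v (a i) (y i)) * f y ∂Measure.pi fun _ : ι => gaussianReal 0 v := by
  have hm : Measurable fun y : ι → ℝ => ∏ i, gaussianShift v (a i) (y i) :=
    Finset.measurable_prod _ fun i _ =>
      (measurable_gaussianShift v (a i)).comp (measurable_pi_apply i)
  have hp : MeasurePreserving (fun e : ι → ℝ => a + e) (Measure.pi fun _ : ι => gaussianReal 0 v)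
      (Measure.pi fun i => gaussianReal (a i) v) := by
    refine measurePreserving_pi (f := fun i x => a i + x) _ _ fun i => ⟨by fun_prop, ?_⟩
    have := gaussianReal_map_const_add (μ := 0) (v := v) (a i)
    simpa using this
  rw [hp.lintegral_comp hf, ← pi_gaussian_withDensity_shift hv,
    lintegral_withDensity_eq_lintegral_mul _ hm hf]
  rfl

theorem lintegral_prod_gaussianShift_sq {ι : Type*} [Fintype ι] {v : NNReal} (hv : v ≠ 0)
    (a : ι → ℝ) :
    ∫⁻ y, (∏ i, gaussianShift v (a i) (y i)) ^ 2 ∂Measure.pi (fun _ : ι => gaussianReal 0 v) =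
      ENNReal.ofReal (Real.exp ((∑ i, a i ^ 2) / v)) := by
  simp_rw [← Finset.prod_pow]
  rw [lintegral_pi_prod (fun _ : ι => gaussianReal 0 v)
    (f := fun i y => gaussianShift v (a i) y ^ 2)
    fun i => (measurable_gaussianShift v (a i)).pow_const 2]
  simp_rw [lintegral_gaussianShift_sq hv]
  rw [← ENNReal.ofReal_prod_of_nonneg fun _ _ => by positivity, ← Real.exp_sum, Finset.sum_div]

theorem sq_lintegral_mul_le {α : Type*} [MeasurableSpace α] (μ : Measure α) {f g : α → ℝ≥0∞}
    (hf : AEMeasurable f μ) (hg : AEMeasurable g μ) :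
    (∫⁻ x, f x * g x ∂μ) ^ 2 ≤ (∫⁻ x, f x ^ 2 ∂μ) * ∫⁻ x, g x ^ 2 ∂μ := by
  have h := ENNReal.lintegral_mul_le_Lp_mul_Lq μ Real.HolderConjugate.two_two hf hg
  calc _ ≤ _ := pow_le_pow_left' h 2
    _ = _ := by
      rw [mul_pow, ← ENNReal.rpow_natCast, ← ENNReal.rpow_natCast, ← ENNReal.rpow_mul,
        ← ENNReal.rpow_mul]
      norm_num

/-- Second-moment change of measure: a Gaussian location model is compared with pure noise. -/
theorem sq_measure_gaussian_location_le {ι Θ : Type*} [Fintype ι] [MeasurableSpace Θ]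
    (π : Measure Θ) [IsProbabilityMeasure π] {v : NNReal} (hv : v ≠ 0) {a : Θ → ι → ℝ}
    (ha : Measurable a) {G : Set (Θ × (ι → ℝ))} (hG : MeasurableSet G) :
    (π.prod (Measure.pi fun _ : ι => gaussianReal 0 v)) {z | (z.1, a z.1 + z.2) ∈ G} ^ 2 ≤
      (∫⁻ θ, ENNReal.ofReal (Real.exp ((∑ i, a θ i ^ 2) / v)) ∂π) *
        (π.prod (Measure.pi fun _ : ι => gaussianReal 0 v)) G := by
  set N := Measure.pi fun _ : ι => gaussianReal 0 v
  have hL : Measurable fun z : Θ × (ι → ℝ) => ∏ i, gaussianShift v (a z.1 i) (z.2 i) := by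
    refine Finset.measurable_prod _ fun i _ => ?_
    unfold gaussianShift
    have h1 : Measurable fun z : Θ × (ι → ℝ) => a z.1 i :=
      (measurable_pi_apply i).comp (ha.comp measurable_fst)
    have h2 : Measurable fun z : Θ × (ι → ℝ) => z.2 i :=
      (measurable_pi_apply i).comp measurable_snd
    fun_prop
  have hI : Measurable (G.indicator (1 : Θ × (ι → ℝ) → ℝ≥0∞)) := measurable_one.indicator hG
  have hS : MeasurableSet {z : Θ × (ι → ℝ) | (z.1, a z.1 + z.2) ∈ G} :=
    (measurable_fst.prodMk ((ha.comp measurable_fst).add measurable_snd)) hG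
  -- For each fixed `θ`, translating the noise by `a θ` is the same as inserting the likelihood
  -- ratio.
  have h1 : (π.prod N) {z | (z.1, a z.1 + z.2) ∈ G} =
      ∫⁻ z, (∏ i, gaussianShift v (a z.1 i) (z.2 i)) * G.indicator 1 z ∂π.prod N := by
    rw [← lintegral_indicator_one hS, lintegral_prod _ (measurable_one.indicator hS).aemeasurable,
      lintegral_prod (fun z : Θ × (ι → ℝ) =>
        (∏ i, gaussianShift v (a z.1 i) (z.2 i)) * G.indicator 1 z) (hL.mul hI).aemeasurable]
    refine lintegral_congr fun θ => ?_
    rw [← lintegral_pi_gaussian_add hv (a θ) (f := fun y => G.indicator 1 (θ, y))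
      (hI.comp measurable_prodMk_left)]
    rfl
  rw [h1]
  refine (sq_lintegral_mul_le _ hL.aemeasurable hI.aemeasurable).trans (le_of_eq ?_)
  congr 1
  · rw [lintegral_prod _ (hL.pow_const 2).aemeasurable]
    exact lintegral_congr fun θ => lintegral_prod_gaussianShift_sq hv (a θ)
  · rw [← lintegral_indicator_one hG]
    refine lintegral_congr fun z => ?_
    by_cases h : z ∈ G <;> simp [h]

/-! ### Law of the noise matrix -/

theorem map_noise_eq {Ω : Type*} [MeasurableSpace Ω] {P : Measure Ω} [IsProbabilityMeasure P]
    {n₁ n₂ : ℕ} {σ : ℝ} {ξ : Fin n₁ → Fin n₂ → Ω → ℝ} (h : IsGaussianNoise P σ ξ) :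
    AEMeasurable (fun ω i j => ξ i j ω) P ∧
    P.map (fun ω i j => ξ i j ω) =
      Measure.pi fun _ : Fin n₁ => Measure.pi fun _ : Fin n₂ =>
        gaussianReal 0 (σ ^ 2).toNNReal := by
  set g := gaussianReal 0 (σ ^ 2).toNNReal
  have hm : ∀ i j, AEMeasurable (ξ i j) P := fun i j => (h.hasLaw i j).aemeasurable
  have h1 : P.map (fun ω (ij : Fin n₁ × Fin n₂) => ξ ij.1 ij.2 ω) =
      Measure.pi fun _ : Fin n₁ × Fin n₂ => g := by
    rw [(iIndepFun_iff_map_fun_eq_pi_map fun ij : Fin n₁ × Fin n₂ => hm ij.1 ij.2).1 h.indep]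
    congr 1
    ext1 ij
    exact (h.hasLaw ij.1 ij.2).map_eq
  have hu : Measurable fun (x : Fin n₁ → Fin n₂ → ℝ) (ij : Fin n₁ × Fin n₂) => x ij.1 ij.2 := by
    fun_prop
  have hc : Measurable fun (x : Fin n₁ × Fin n₂ → ℝ) (i : Fin n₁) (j : Fin n₂) => x (i, j) := by
    fun_prop
  have h2 : (Measure.pi fun _ : Fin n₁ × Fin n₂ => g) =
      (Measure.pi fun _ : Fin n₁ => Measure.pi fun _ : Fin n₂ => g).map
        fun x ij => x ij.1 ij.2 := by
    refine Measure.pi_eq fun s hs => ?_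
    rw [Measure.map_apply hu (MeasurableSet.univ_pi hs)]
    have : (fun (x : Fin n₁ → Fin n₂ → ℝ) (ij : Fin n₁ × Fin n₂) => x ij.1 ij.2) ⁻¹'
        (Set.univ.pi s) = Set.univ.pi fun i => Set.univ.pi fun j => s (i, j) := by
      ext x; simp
    rw [this, Measure.pi_pi]
    simp_rw [Measure.pi_pi]
    rw [Fintype.prod_prod_type]
  refine ⟨by fun_prop, ?_⟩
  have h3 : P.map (fun ω i j => ξ i j ω) =
      (P.map (fun ω (ij : Fin n₁ × Fin n₂) => ξ ij.1 ij.2 ω)).map fun x i j => x (i, j) := by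
    rw [AEMeasurable.map_map_of_aemeasurable hc.aemeasurable (by fun_prop)]
    rfl
  rw [h3, h1, h2, Measure.map_map hc hu]
  exact Measure.map_id

/-! ### Small balls for a single spike -/

/-- A uniform position in a block of length `m` together with an independent uniform magnitude. -/
noncomputable def blockMeasure (m : ℕ) : Measure (Fin m × unitInterval) :=
  ((m : ℝ≥0∞)⁻¹ • Measure.count).prod volume

instance (m : ℕ) [NeZero m] : IsProbabilityMeasure (blockMeasure m) := by
  have : IsProbabilityMeasure ((m : ℝ≥0∞)⁻¹ • (Measure.count : Measure (Fin m))) := ⟨by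
    simp [Measure.count_apply, ENNReal.inv_mul_cancel, NeZero.ne m]⟩
  unfold blockMeasure
  infer_instance

/-- The squared distance from `z` to the vector with the single entry `τ (1 + u)` at `w.1`. -/
def spikeDist {m : ℕ} (τ : ℝ) (z : Fin m → ℝ) (w : Fin m × unitInterval) : ℝ :=
  ∑ k, (z k - if k = w.1 then τ * (1 + w.2) else 0) ^ 2

theorem measurable_spikeDist {m : ℕ} (τ : ℝ) (z : Fin m → ℝ) : Measurable (spikeDist τ z) := by
  unfold spikeDist
  refine Finset.measurable_sum _ fun k _ => Measurable.pow_const (measurable_const.sub ?_) 2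
  refine Measurable.ite ?_ (by fun_prop) measurable_const
  exact measurable_fst (MeasurableSet.of_discrete (s := {i : Fin m | k = i}))

/-- Being within `η τ` of `z` fixes the position, which costs `1 / m`, and confines `u` to an
interval of length `2η`. -/
theorem blockMeasure_spikeDist_le {m : ℕ} {τ η : ℝ} (hτ : 0 < τ) (hη : 0 < η)
    (hη' : η < 1 / 2) (z : Fin m → ℝ) :
    blockMeasure m {w | spikeDist τ z w ≤ (η * τ) ^ 2} ≤ ENNReal.ofReal (2 * η / m) := by
  have hητ : 0 < η * τ := by positivity
  have key : ∀ w, spikeDist τ z w ≤ (η * τ) ^ 2 → ∀ k,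
      |z k - if k = w.1 then τ * (1 + w.2) else 0| ≤ η * τ := by
    intro w hw k
    refine abs_le_of_sq_le_sq (le_trans ?_ hw) hητ.le
    exact Finset.single_le_sum (f := fun k => (z k - if k = w.1 then τ * (1 + (w.2 : ℝ)) else 0) ^ 2)
      (fun _ _ => sq_nonneg _) (Finset.mem_univ k)
  rcases Set.eq_empty_or_nonempty {w | spikeDist τ z w ≤ (η * τ) ^ 2} with h | ⟨w₀, h₀⟩
  · simp [h]
  have hm : (0 : ℝ) < m := by exact_mod_cast w₀.1.pos
  have hsub : {w | spikeDist τ z w ≤ (η * τ) ^ 2} ⊆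
      {w₀.1} ×ˢ {u : unitInterval | (u : ℝ) ∈ Set.Icc (z w₀.1 / τ - 1 - η) (z w₀.1 / τ - 1 + η)} := by
    intro w hw
    -- At two different positions, `z w₀.1` would be both at least `τ - η τ` and at most `η τ`,
    -- impossible for `η < 1 / 2`.
    have hk : w.1 = w₀.1 := by
      by_contra hne
      have h1 := key w₀ h₀ w₀.1
      have h2 := key w hw w₀.1
      rw [if_pos rfl, abs_le] at h1
      rw [if_neg (Ne.symm hne), abs_le] at h2
      have := w₀.2.2.1
      nlinarith
    refine ⟨hk, ?_⟩
    have h1 := key w hw w₀.1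
    rw [if_pos hk.symm, abs_le] at h1
    have h2 : z w₀.1 / τ * τ = z w₀.1 := div_mul_cancel₀ _ hτ.ne'
    constructor <;> refine le_of_mul_le_mul_right ?_ hτ <;> nlinarith
  refine (measure_mono hsub).trans ?_
  rw [blockMeasure, Measure.prod_prod, Measure.smul_apply, Measure.count_singleton,
    smul_eq_mul, mul_one, unitInterval.volume_apply]
  calc _ ≤ (m : ℝ≥0∞)⁻¹ * ENNReal.ofReal (2 * η) := by
        gcongr
        refine (measure_mono (t := Set.Icc (z w₀.1 / τ - 1 - η) (z w₀.1 / τ - 1 + η)) ?_).trans ?_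
        · rintro _ ⟨u, hu, rfl⟩; exact hu
        · rw [Real.volume_Icc]
          exact ENNReal.ofReal_le_ofReal (by linarith)
    _ = _ := by
        rw [ENNReal.ofReal_div_of_pos hm, ENNReal.ofReal_natCast, mul_comm]
        rfl

/-! ### The sparse prior and the risk in one row -/

section

variable {n s m : ℕ}

/-- The `s`-sparse vector with one entry `τ (1 + u)` in each of `s` disjoint blocks. -/
def blockVector (emb : Fin s × Fin m → Fin n) (τ : ℝ) (θ : Fin s → Fin m × unitInterval) :
    Fin n → ℝ :=
  fun j => ∑ b, if emb (b, (θ b).1) = j then τ * (1 + (θ b).2) else 0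

theorem measurable_blockVector (emb : Fin s × Fin m → Fin n) (τ : ℝ) :
    Measurable (blockVector emb τ) := by
  refine measurable_pi_lambda _ fun j => Finset.measurable_sum _ fun b _ => ?_
  refine Measurable.ite ?_ (by fun_prop) measurable_const
  exact (measurable_fst.comp (measurable_pi_apply b))
    (MeasurableSet.of_discrete (s := {k : Fin m | emb (b, k) = j}))

theorem blockVector_apply_emb {emb : Fin s × Fin m → Fin n} (hemb : Function.Injective emb)
    (τ : ℝ) (θ : Fin s → Fin m × unitInterval) (b : Fin s) (k : Fin m) :
    blockVector emb τ θ (emb (b, k)) = if k = (θ b).1 then τ * (1 + (θ b).2) else 0 := by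
  unfold blockVector
  rw [Finset.sum_eq_single b]
  · simp [hemb.eq_iff, eq_comm]
  · intro b' _ hb
    simp [hemb.eq_iff, hb]
  · simp

theorem blockVector_eq_zero {emb : Fin s × Fin m → Fin n} {τ : ℝ}
    {θ : Fin s → Fin m × unitInterval} {j : Fin n}
    (hj : j ∉ Finset.univ.image fun b => emb (b, (θ b).1)) : blockVector emb τ θ j = 0 := by
  refine Finset.sum_eq_zero fun b _ => if_neg fun h => hj ?_
  exact Finset.mem_image.2 ⟨b, Finset.mem_univ b, h⟩

theorem blockVector_mem_sparseBall (emb : Fin s × Fin m → Fin n) (τ : ℝ)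
    (θ : Fin s → Fin m × unitInterval) : blockVector emb τ θ ∈ sparseBall n s := by
  have h : (Finset.univ.filter fun j => blockVector emb τ θ j ≠ 0) ⊆
      Finset.univ.image fun b => emb (b, (θ b).1) := by
    intro j hj
    by_contra h
    exact (Finset.mem_filter.1 hj).2 (blockVector_eq_zero h)
  change hammingNorm (blockVector emb τ θ) ≤ s
  rw [hammingNorm]
  exact ((Finset.card_le_card h).trans Finset.card_image_le).trans (by simp)

theorem sum_blockVector_sq_le {emb : Fin s × Fin m → Fin n} (hemb : Function.Injective emb)
    (τ : ℝ) (θ : Fin s → Fin m × unitInterval) :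
    ∑ j, blockVector emb τ θ j ^ 2 ≤ s * (4 * τ ^ 2) := by
  rw [← Finset.sum_subset (Finset.subset_univ (Finset.univ.image fun b => emb (b, (θ b).1)))
    fun j _ hj => by rw [blockVector_eq_zero hj]; simp]
  rw [Finset.sum_image fun b _ b' _ h => (Prod.ext_iff.1 (hemb h)).1]
  refine (Finset.sum_le_card_nsmul _ _ (4 * τ ^ 2) fun b _ => ?_).trans (by simp)
  rw [blockVector_apply_emb hemb, if_pos rfl]
  have h0 := (θ b).2.2.1
  have h1 := (θ b).2.2.2
  rw [mul_pow, mul_comm]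
  gcongr
  nlinarith

theorem sum_spikeDist_le {emb : Fin s × Fin m → Fin n} (hemb : Function.Injective emb)
    (τ : ℝ) (θ : Fin s → Fin m × unitInterval) (x : Fin n → ℝ) :
    ∑ b, spikeDist τ (fun k => x (emb (b, k))) (θ b) ≤ ∑ j, (x j - blockVector emb τ θ j) ^ 2 := by
  calc _ = ∑ bk : Fin s × Fin m, (x (emb bk) - blockVector emb τ θ (emb bk)) ^ 2 := by
        rw [Fintype.sum_prod_type]
        refine Finset.sum_congr rfl fun b _ => Finset.sum_congr rfl fun k _ => ?_
        rw [blockVector_apply_emb hemb]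
    _ = ∑ j ∈ Finset.univ.map ⟨emb, hemb⟩, (x j - blockVector emb τ θ j) ^ 2 := by
        rw [Finset.sum_map]; rfl
    _ ≤ _ := Finset.sum_le_sum_of_subset_of_nonneg (Finset.subset_univ _)
        fun _ _ _ => sq_nonneg _

/-- The prior on the parameters of an `s`-sparse vector. -/
noncomputable def blockPrior (s m : ℕ) : Measure (Fin s → Fin m × unitInterval) :=
  Measure.pi fun _ => blockMeasure m

instance [NeZero m] : IsProbabilityMeasure (blockPrior s m) := by
  unfold blockPrior; infer_instance

/-- The Chernoff weight: at most half of the blocks can have `d b > c`, so the factors `r⁻¹` are at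
least as many as the factors `r`. -/
theorem one_le_prod_of_few_bad {r c : ℝ} (hr : 0 < r) (hr1 : r ≤ 1) (hc : 0 < c) {d : Fin s → ℝ}
    (hd : ∀ b, 0 ≤ d b) (h : ∑ b, d b ≤ c * s / 2) :
    1 ≤ ∏ b, if d b ≤ c then r⁻¹ else r := by
  classical
  rw [Finset.prod_ite, Finset.prod_const, Finset.prod_const]
  set g := (Finset.univ.filter fun b => d b ≤ c).card
  set B := (Finset.univ.filter fun b => ¬ d b ≤ c).card with hB
  have hs : g + B = s := by
    have := Finset.card_filter_add_card_filter_not (s := (Finset.univ : Finset (Fin s)))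
      (fun b => d b ≤ c)
    exact this.trans (by simp)
  have h1 : B * c ≤ c * s / 2 := by
    refine le_trans ?_ h
    calc (B : ℝ) * c = ∑ b ∈ Finset.univ.filter (fun b => ¬ d b ≤ c), c := by simp [hB]
      _ ≤ ∑ b ∈ Finset.univ.filter (fun b => ¬ d b ≤ c), d b :=
          Finset.sum_le_sum fun b hb => (not_le.1 (Finset.mem_filter.1 hb).2).le
      _ ≤ _ := Finset.sum_le_sum_of_subset_of_nonneg (Finset.filter_subset _ _)
          fun b _ _ => hd b
  have h2 : B ≤ g := by
    have : (B : ℝ) * 2 ≤ s := by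
      refine le_of_mul_le_mul_right ?_ hc
      linarith
    have : B * 2 ≤ s := by exact_mod_cast this
    omega
  calc (1 : ℝ) = r⁻¹ ^ B * r ^ B := by rw [← mul_pow, inv_mul_cancel₀ hr.ne', one_pow]
    _ ≤ _ := by
      gcongr
      exact (one_le_inv₀ hr).2 hr1

/-- An exponential Markov bound over independent blocks. A block is good with probability at most
`2η / m = r²`, so its weight has mean at most `r⁻¹ r² + r = 2r`; this choice of `r` balances the two
terms. -/
theorem blockPrior_small_ball [NeZero m] {emb : Fin s × Fin m → Fin n}
    (hemb : Function.Injective emb)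
    {τ η r : ℝ} (hτ : 0 < τ) (hη : 0 < η) (hη' : η < 1 / 2) (hr : 0 < r) (hr1 : r ≤ 1)
    (hrη : r ^ 2 = 2 * η / m) (x : Fin n → ℝ) :
    blockPrior s m {θ | ∑ j, (x j - blockVector emb τ θ j) ^ 2 ≤ (η * τ) ^ 2 * s / 2} ≤
      ENNReal.ofReal (2 * r) ^ s := by
  classical
  set D : Fin s → Fin m × unitInterval → ℝ := fun b => spikeDist τ fun k => x (emb (b, k)) with hD
  set S : Fin s → Set (Fin m × unitInterval) := fun b => {w | D b w ≤ (η * τ) ^ 2} with hS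
  have hSm : ∀ b, MeasurableSet (S b) := fun b =>
    measurableSet_le (measurable_spikeDist _ _) measurable_const
  set W : Fin s → Fin m × unitInterval → ℝ≥0∞ := fun b w =>
    ENNReal.ofReal (if D b w ≤ (η * τ) ^ 2 then r⁻¹ else r) with hW
  have hWm : ∀ b, Measurable (W b) := fun b =>
    (Measurable.ite (hSm b) measurable_const measurable_const).ennreal_ofReal
  have hWi : ∀ b, ∫⁻ w, W b w ∂blockMeasure m ≤ ENNReal.ofReal (2 * r) := by
    intro b
    calc ∫⁻ w, W b w ∂blockMeasure m
        ≤ ∫⁻ w, (S b).indicator (fun _ => ENNReal.ofReal r⁻¹) w + ENNReal.ofReal r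
            ∂blockMeasure m := by
          refine lintegral_mono fun w => ?_
          by_cases h : D b w ≤ (η * τ) ^ 2
          · rw [Set.indicator_of_mem (show w ∈ S b from h)]
            simp [hW, h]
          · simp [hW, h]
      _ = ENNReal.ofReal r⁻¹ * blockMeasure m (S b) + ENNReal.ofReal r := by
          rw [lintegral_add_right _ measurable_const, lintegral_indicator_const (hSm b)]
          simp
      _ ≤ ENNReal.ofReal r⁻¹ * ENNReal.ofReal (2 * η / m) + ENNReal.ofReal r := by
          gcongr
          exact blockMeasure_spikeDist_le hτ hη hη' _
      _ = _ := by
          rw [← ENNReal.ofReal_mul (by positivity), ← ENNReal.ofReal_add (by positivity) hr.le,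
            ← hrη]
          congr 1
          field_simp
          ring
  set G := {θ | ∑ j, (x j - blockVector emb τ θ j) ^ 2 ≤ (η * τ) ^ 2 * s / 2} with hG
  have hGm : MeasurableSet G := by
    refine measurableSet_le (Finset.measurable_sum _ fun j _ => ?_) measurable_const
    exact (measurable_const.sub ((measurable_pi_apply j).comp
      (measurable_blockVector emb τ))).pow_const 2
  calc blockPrior s m G = ∫⁻ θ, G.indicator 1 θ ∂blockPrior s m := (lintegral_indicator_one hGm).symm
    _ ≤ ∫⁻ θ, ∏ b, W b (θ b) ∂blockPrior s m := by
      refine lintegral_mono fun θ => ?_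
      by_cases h : θ ∈ G
      · rw [Set.indicator_of_mem h, Pi.one_apply, ← ENNReal.ofReal_prod_of_nonneg fun b _ => by
          split_ifs <;> positivity, ENNReal.one_le_ofReal]
        exact one_le_prod_of_few_bad hr hr1 (by positivity)
          (fun b => Finset.sum_nonneg fun _ _ => sq_nonneg _)
          ((sum_spikeDist_le hemb τ θ x).trans h)
      · simp [Set.indicator_of_notMem h]
    _ = ∏ b, ∫⁻ w, W b w ∂blockMeasure m := lintegral_pi_prod _ hWm
    _ ≤ ∏ _b : Fin s, ENNReal.ofReal (2 * r) := Finset.prod_le_prod' fun b _ => hWi b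
    _ = _ := by simp

/-- A quantitative lower bound on the risk in one row. -/
theorem row_estimation_error_prob [NeZero m] {emb : Fin s × Fin m → Fin n}
    (hemb : Function.Injective emb) (hs : s ≠ 0) {v : NNReal} (hv : v ≠ 0) {τ η : ℝ} (hτ : 0 < τ)
    (hm : Real.exp (4 * τ ^ 2 / v) ^ 2 ≤ m) (hη : 0 < η) (hη' : 8 * η ≤ 1)
    {h : (Fin n → ℝ) → Fin n → ℝ} (hh : Measurable h) :
    ((blockPrior s m).prod (Measure.pi fun _ : Fin n => gaussianReal 0 v))
      {z | ∑ j, (h (blockVector emb τ z.1 + z.2) j - blockVector emb τ z.1 j) ^ 2 ≤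
        (η * τ) ^ 2 * s / 2} ^ 4 ≤ ENNReal.ofReal (8 * η) := by
  have hm0 : (1 : ℝ) ≤ m := by exact_mod_cast Nat.one_le_iff_ne_zero.2 (NeZero.ne m)
  set r := √(2 * η / m)
  have hr2 : r ^ 2 = 2 * η / m := Real.sq_sqrt (by positivity)
  have hr : 0 < r := Real.sqrt_pos.2 (by positivity)
  have hr1 : r ≤ 1 := by
    refine Real.sqrt_le_one.2 ?_
    rw [div_le_one (by linarith)]
    linarith
  set G : Set ((Fin s → Fin m × unitInterval) × (Fin n → ℝ)) :=
    {z | ∑ j, (h z.2 j - blockVector emb τ z.1 j) ^ 2 ≤ (η * τ) ^ 2 * s / 2} with hG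
  have hGm : MeasurableSet G := by
    refine measurableSet_le (Finset.measurable_sum _ fun j _ => ?_) measurable_const
    exact (((measurable_pi_apply j).comp (hh.comp measurable_snd)).sub ((measurable_pi_apply j).comp
      ((measurable_blockVector emb τ).comp measurable_fst))).pow_const 2
  have h1 := sq_measure_gaussian_location_le (blockPrior s m) hv (measurable_blockVector emb τ) hGm
  set N := Measure.pi fun _ : Fin n => gaussianReal 0 v
  -- Here the data `y` are independent of `θ`, so `h y` is a fixed centre for the small-ball bound.
  have h2 : (blockPrior s m).prod N G ≤ ENNReal.ofReal (2 * r) ^ s := by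
    rw [Measure.prod_apply_symm hGm]
    refine (lintegral_mono (g := fun _ => ENNReal.ofReal (2 * r) ^ s) fun y => ?_).trans (by simp)
    exact blockPrior_small_ball hemb hτ hη (by linarith) hr hr1 hr2 (h y)
  have h3 : ∫⁻ θ, ENNReal.ofReal (Real.exp ((∑ i, blockVector emb τ θ i ^ 2) / v))
      ∂blockPrior s m ≤ ENNReal.ofReal (Real.exp (4 * τ ^ 2 / v)) ^ s := by
    refine (lintegral_mono (g := fun _ => ENNReal.ofReal (Real.exp (4 * τ ^ 2 / v)) ^ s)
      fun θ => ?_).trans (by simp)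
    rw [← ENNReal.ofReal_pow (by positivity), ← Real.exp_nat_mul]
    refine ENNReal.ofReal_le_ofReal (Real.exp_le_exp.2 ?_)
    rw [mul_div_assoc']
    gcongr
    exact sum_blockVector_sq_le hemb τ θ
  set X := Real.exp (4 * τ ^ 2 / v) * (2 * r) with hX
  have hX0 : 0 ≤ X := by positivity
  -- The factor `1 / m` in `r²` absorbs the second-moment cost, by `hm`.
  have hX2 : X ^ 2 ≤ 8 * η := by
    calc X ^ 2 = Real.exp (4 * τ ^ 2 / v) ^ 2 * (4 * r ^ 2) := by rw [hX]; ring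
      _ ≤ m * (4 * r ^ 2) := by gcongr
      _ = 8 * η := by rw [hr2]; field_simp; ring
  have hX1 : X ≤ 1 := by nlinarith
  have h4 : ((blockPrior s m).prod N) {z | (z.1, blockVector emb τ z.1 + z.2) ∈ G} ^ 2 ≤
      ENNReal.ofReal X := by
    refine h1.trans ((mul_le_mul' h3 h2).trans ?_)
    rw [← mul_pow, ← ENNReal.ofReal_mul (by positivity), ← ENNReal.ofReal_pow hX0]
    exact ENNReal.ofReal_le_ofReal (pow_le_of_le_one hX0 hX1 hs)
  calc _ = (((blockPrior s m).prod N) {z | (z.1, blockVector emb τ z.1 + z.2) ∈ G} ^ 2) ^ 2 := by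
        rw [← pow_mul]; rfl
    _ ≤ ENNReal.ofReal X ^ 2 := pow_le_pow_left' h4 2
    _ ≤ _ := by
      rw [← ENNReal.ofReal_pow hX0]
      exact ENNReal.ofReal_le_ofReal hX2

/-! ### From row errors to the mixed norm -/

/-- Conditioning on all coordinates but the `i`-th: a bound uniform in the others survives
integration. -/
theorem pi_measure_le_of_insertNth_le {k : ℕ} {Z : Type*} [MeasurableSpace Z] (μ : Measure Z)
    [IsProbabilityMeasure μ] (i : Fin (k + 1)) {S : Set (Fin (k + 1) → Z)} (hS : MeasurableSet S)
    {c : ℝ≥0∞} (h : ∀ y : Fin k → Z, μ {z | i.insertNth z y ∈ S} ≤ c) :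
    Measure.pi (fun _ : Fin (k + 1) => μ) S ≤ c := by
  have hp := (measurePreserving_piFinSuccAbove (fun _ : Fin (k + 1) => μ) i).symm
  rw [← hp.measure_preimage hS.nullMeasurableSet, Measure.prod_apply_symm (hp.measurable hS)]
  refine (lintegral_mono (g := fun _ => c) fun y => ?_).trans (by simp)
  exact h y

/-- The number of geometric scales `c / 256 ^ k` that are not exceeded by `d`. -/
noncomputable def scaleCount (c d : ℝ) : ℝ≥0∞ :=
  ∑' k : ℕ, (Set.Iic (c / 256 ^ k)).indicator 1 d

theorem measurable_scaleCount (c : ℝ) : Measurable (scaleCount c) :=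
  Measurable.tsum fun _ => measurable_one.indicator measurableSet_Iic

/-- `N` is the first scale strictly below `d`; the `N` earlier scales are all counted. If no scale
lies below `d`, the count is infinite. -/
theorem exists_scale_of_scaleCount_ne_top {c d : ℝ} (h : scaleCount c d ≠ ⊤) :
    ∃ N : ℕ, (N : ℝ≥0∞) ≤ scaleCount c d ∧ c / 256 ^ N ≤ d := by
  classical
  have hex : ∃ N : ℕ, c / 256 ^ N < d := by
    by_contra! hall
    refine h ?_
    have : ∀ k : ℕ, (Set.Iic (c / 256 ^ k)).indicator (1 : ℝ → ℝ≥0∞) d = 1 := fun k =>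
      Set.indicator_of_mem (show d ∈ Set.Iic (c / 256 ^ k) from hall k) _
    simp_rw [scaleCount, this]
    exact ENNReal.tsum_const_eq_top_of_ne_zero one_ne_zero
  refine ⟨Nat.find hex, ?_, (Nat.find_spec hex).le⟩
  refine le_trans (le_of_eq ?_) (ENNReal.sum_le_tsum (Finset.range (Nat.find hex)))
  rw [Finset.sum_congr rfl fun k hk => Set.indicator_of_mem
    (show d ∈ Set.Iic (c / 256 ^ k) from
      not_lt.1 (Nat.find_min hex (Finset.mem_range.1 hk))) _]
  simp

/-- The power mean of the row norms is at least their geometric mean. The average scale index is at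
most 4, so the loss in the square is `256 ^ 4 = 16 ^ 8`. -/
theorem mixedNorm_sq_ge_of_scaleCount {n₁ n₂ : ℕ} (hn : n₁ ≠ 0) {p c : ℝ} (hp : 0 < p) (hc : 0 < c)
    (B : Matrix (Fin n₁) (Fin n₂) ℝ)
    (h : ∑ i, scaleCount c (∑ j, B i j ^ 2) < 4 * n₁) :
    (n₁ : ℝ) ^ (2 / p) * (c / 16 ^ 8) ≤ mixedNorm p B ^ 2 := by
  have hfin : ∀ i, scaleCount c (∑ j, B i j ^ 2) ≠ ⊤ := fun i =>
    ((Finset.single_le_sum (f := fun i => scaleCount c (∑ j, B i j ^ 2)) (fun _ _ => zero_le)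
      (Finset.mem_univ i)).trans_lt (h.trans_le le_top)).ne
  choose N hN hNd using fun i => exists_scale_of_scaleCount_ne_top (hfin i)
  have hsum : ∑ i, (N i : ℝ) ≤ 4 * n₁ := by
    have : ((∑ i, N i : ℕ) : ℝ≥0∞) ≤ ((4 * n₁ : ℕ) : ℝ≥0∞) := by
      push_cast
      exact (Finset.sum_le_sum fun i _ => hN i).trans h.le
    exact_mod_cast this
  have hn' : (0 : ℝ) < n₁ := by positivity
  set l := Real.log 16
  have hl : 0 < l := Real.log_pos (by norm_num)
  have hrow : ∀ i, √c * Real.exp (-(l * N i)) ≤ ‖WithLp.toLp 2 (B.row i)‖ := by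
    intro i
    rw [EuclideanSpace.norm_eq]
    refine Real.le_sqrt_of_sq_le ?_
    have h1 : (√c * Real.exp (-(l * N i))) ^ 2 = c / 256 ^ N i := by
      have h2 : Real.exp (l * N i) = 16 ^ N i := by
        rw [mul_comm, Real.exp_nat_mul, Real.exp_log (by norm_num)]
      rw [mul_pow, Real.sq_sqrt hc.le, Real.exp_neg, h2, inv_pow, ← pow_mul, mul_comm (N i),
        pow_mul]
      norm_num
      rfl
    rw [h1]
    simpa [Matrix.row] using hNd i
  -- The tangent line to `exp` at `-4lp`; summed over rows, its linear part is nonnegative because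
  -- the `N i` average at most 4.
  have hterm : ∀ i, √c ^ p * (Real.exp (-(4 * l * p)) * (1 + (4 * l * p - p * (l * N i)))) ≤
      ‖WithLp.toLp 2 (B.row i)‖ ^ p := by
    intro i
    calc _ ≤ √c ^ p * (Real.exp (-(4 * l * p)) * Real.exp (4 * l * p - p * (l * N i))) := by
          gcongr
          linarith [Real.add_one_le_exp (4 * l * p - p * (l * N i))]
      _ = (√c * Real.exp (-(l * N i))) ^ p := by
          rw [Real.mul_rpow (by positivity) (by positivity), ← Real.exp_mul, ← Real.exp_add]
          ring_nf
      _ ≤ _ := Real.rpow_le_rpow (by positivity) (hrow i) hp.le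
  have htot : n₁ * (√c * Real.exp (-(4 * l))) ^ p ≤ ∑ i, ‖WithLp.toLp 2 (B.row i)‖ ^ p := by
    refine le_trans ?_ (Finset.sum_le_sum fun i _ => hterm i)
    rw [← Finset.mul_sum, ← Finset.mul_sum, Real.mul_rpow (by positivity) (by positivity),
      ← Real.exp_mul, mul_left_comm, neg_mul, mul_comm (n₁ : ℝ)]
    gcongr
    simp only [Finset.sum_add_distrib, Finset.sum_sub_distrib, Finset.sum_const, Finset.card_univ,
      Fintype.card_fin, nsmul_eq_mul, ← Finset.mul_sum]
    have : p * (l * ∑ i, (N i : ℝ)) ≤ p * (l * (4 * n₁)) := by gcongr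
    linarith
  have hfinal : (n₁ : ℝ) ^ (1 / p) * (√c * Real.exp (-(4 * l))) ≤ mixedNorm p B := by
    refine le_trans (le_of_eq ?_) (Real.rpow_le_rpow (by positivity) htot (by positivity))
    rw [Real.mul_rpow (by positivity) (by positivity), ← Real.rpow_mul (by positivity),
      mul_one_div_cancel hp.ne', Real.rpow_one]
  refine le_trans (le_of_eq ?_) (pow_le_pow_left₀ (by positivity) hfinal 2)
  have h16 : Real.exp (-(4 * l)) = (16 ^ 4)⁻¹ := by
    rw [Real.exp_neg, show (4 : ℝ) * l = (4 : ℕ) * l by norm_num, Real.exp_nat_mul,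
      Real.exp_log (by norm_num)]
  rw [h16, mul_pow, mul_pow, Real.sq_sqrt hc.le, ← Real.rpow_natCast ((n₁ : ℝ) ^ (1 / p)) 2,
    ← Real.rpow_mul (by positivity)]
  have : 1 / p * ((2 : ℕ) : ℝ) = 2 / p := by push_cast; ring
  rw [this, inv_pow, ← pow_mul, mul_comm c]
  norm_num [div_eq_inv_mul]

/-- For every estimator some matrix in the support of the prior has few small row errors. -/
theorem exists_rows_scaleCount_lt [NeZero m] {n₁ : ℕ} (hn₁ : n₁ ≠ 0) {emb : Fin s × Fin m → Fin n}
    (hemb : Function.Injective emb) (hs : s ≠ 0) {v : NNReal} (hv : v ≠ 0) {τ : ℝ} (hτ : 0 < τ)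
    (hm : Real.exp (4 * τ ^ 2 / v) ^ 2 ≤ m)
    {f : (Fin n₁ → Fin n → ℝ) → Fin n₁ → Fin n → ℝ} (hf : Measurable f) :
    ∃ A : Fin n₁ → Fin n → ℝ, (∀ i, A i ∈ sparseBall n s) ∧
      1 / 2 ≤ (Measure.pi fun _ : Fin n₁ => Measure.pi fun _ : Fin n => gaussianReal 0 v)
        {E | ∑ i, scaleCount (τ ^ 2 * s / 128) (∑ j, (f (A + E) i j - A i j) ^ 2) < 4 * n₁} := by
  obtain ⟨k, rfl⟩ := Nat.exists_eq_succ_of_ne_zero hn₁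
  set N := Measure.pi fun _ : Fin n => gaussianReal 0 v
  set a := blockVector emb τ with ha
  have ham : Measurable a := measurable_blockVector emb τ
  set c := τ ^ 2 * s / 128 with hc
  set Z := (Fin s → Fin m × unitInterval) × (Fin n → ℝ)
  set μ : Measure Z := (blockPrior s m).prod N with hμ
  set d : (Fin (k + 1) → Fin s → Fin m × unitInterval) → (Fin (k + 1) → Fin n → ℝ) →
    Fin (k + 1) → ℝ := fun θ E i => ∑ j, (f ((fun i => a (θ i)) + E) i j - a (θ i) j) ^ 2 with hd
  have hdm : ∀ i, Measurable fun q : (Fin (k + 1) → Fin s → Fin m × unitInterval) ×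
      (Fin (k + 1) → Fin n → ℝ) => d q.1 q.2 i := by
    intro i
    have h1 : Measurable fun q : (Fin (k + 1) → Fin s → Fin m × unitInterval) ×
        (Fin (k + 1) → Fin n → ℝ) => fun i => a (q.1 i) :=
      measurable_pi_lambda _ fun i => ham.comp ((measurable_pi_apply i).comp measurable_fst)
    have h2 := hf.comp (h1.add measurable_snd)
    refine Finset.measurable_sum _ fun j _ => Measurable.pow_const (Measurable.sub ?_ ?_) 2
    · exact (measurable_pi_apply j).comp ((measurable_pi_apply i).comp h2)
    · exact (measurable_pi_apply j).comp ((measurable_pi_apply i).comp h1)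
  set e := MeasurableEquiv.arrowProdEquivProdArrow (Fin s → Fin m × unitInterval) (Fin n → ℝ)
    (Fin (k + 1))
  have hmp : MeasurePreserving e (Measure.pi fun _ => μ)
      ((Measure.pi fun _ => blockPrior s m).prod (Measure.pi fun _ => N)) :=
    measurePreserving_arrowProdEquivProdArrow _ _ _ (fun _ => blockPrior s m) fun _ => N
  have hprob : ∀ i (l : ℕ), (Measure.pi fun _ : Fin (k + 1) => μ)
      {z | d (e z).1 (e z).2 i ≤ c / 256 ^ l} ≤ 2⁻¹ ^ l := by
    intro i l
    have hSm : MeasurableSet {z | d (e z).1 (e z).2 i ≤ c / 256 ^ l} :=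
      measurableSet_le ((hdm i).comp e.measurable) measurable_const
    refine pi_measure_le_of_insertNth_le μ i hSm fun y => ?_
    -- With the other rows frozen at `y`, the `i`-th row of the estimator depends on the `i`-th row
    -- of the data alone.
    set h : (Fin n → ℝ) → Fin n → ℝ := fun x =>
      f (i.insertNth (α := fun _ => Fin n → ℝ) x fun l => a (y l).1 + (y l).2) i with hh
    have hhm : Measurable h := by
      refine (measurable_pi_apply i).comp (hf.comp (measurable_pi_lambda _ ?_))
      rw [Fin.forall_iff_succAbove i]
      refine ⟨by simpa using measurable_id', fun l => by simp⟩
    have hη : 8 * ((16 : ℝ) ^ l)⁻¹ / 8 ≤ 1 := by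
      rw [mul_div_assoc, mul_comm, div_mul_cancel₀ _ (by norm_num)]
      exact inv_le_one_of_one_le₀ (one_le_pow₀ (by norm_num))
    -- This `η` gives `8η = 16 ^ (-l)`, whose fourth root is `2 ^ (-l)`, and makes the threshold `(η
    -- τ)² s / 2` equal to `c / 256 ^ l`.
    have key := row_estimation_error_prob hemb hs hv hτ hm (η := ((16 : ℝ) ^ l)⁻¹ / 8)
      (by positivity) (by linarith) hhm
    have hset : {z : Z | i.insertNth (α := fun _ => Z) z y ∈
        {z | d (e z).1 (e z).2 i ≤ c / 256 ^ l}} =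
        {z : Z | ∑ j, (h (a z.1 + z.2) j - a z.1 j) ^ 2 ≤
          (((16 : ℝ) ^ l)⁻¹ / 8 * τ) ^ 2 * s / 2} := by
      ext z
      have h1 : ((fun i' => a ((i.insertNth (α := fun _ => Z) z y : Fin (k + 1) → Z) i').1) +
          fun i' => ((i.insertNth (α := fun _ => Z) z y : Fin (k + 1) → Z) i').2) =
          i.insertNth (α := fun _ => Fin n → ℝ) (a z.1 + z.2) fun l => a (y l).1 + (y l).2 := by
        funext i'
        revert i'
        rw [Fin.forall_iff_succAbove i]
        exact ⟨by simp, fun l => by simp⟩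
      have h2 : d (e (i.insertNth (α := fun _ => Z) z y)).1
          (e (i.insertNth (α := fun _ => Z) z y)).2 i =
          ∑ j, (h (a z.1 + z.2) j - a z.1 j) ^ 2 := by
        have h3 : a ((i.insertNth (α := fun _ => Z) z y : Fin (k + 1) → Z) i).1 = a z.1 := by simp
        have h4 : d (e (i.insertNth (α := fun _ => Z) z y)).1
            (e (i.insertNth (α := fun _ => Z) z y)).2 i = ∑ j, (f
              ((fun i' => a ((i.insertNth (α := fun _ => Z) z y : Fin (k + 1) → Z) i').1) +
                fun i' => ((i.insertNth (α := fun _ => Z) z y : Fin (k + 1) → Z) i').2) i j -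
              a ((i.insertNth (α := fun _ => Z) z y : Fin (k + 1) → Z) i).1 j) ^ 2 := rfl
        rw [h4, h1, h3]
      have h4 : c / 256 ^ l = (((16 : ℝ) ^ l)⁻¹ / 8 * τ) ^ 2 * s / 2 := by
        rw [hc, show (256 : ℝ) = 16 ^ 2 by norm_num, ← pow_mul, mul_comm 2 l, pow_mul]
        field_simp
        ring
      change d (e (i.insertNth (α := fun _ => Z) z y)).1 (e (i.insertNth (α := fun _ => Z) z y)).2 i ≤
        c / 256 ^ l ↔ _
      rw [h2, h4]
      rfl
    rw [hset]
    have h16 : (2⁻¹ : ℝ≥0∞) ^ 4 = 16⁻¹ := by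
      rw [← ENNReal.inv_pow]
      norm_num
    refine (ENNReal.pow_right_strictMono (n := 4) (by norm_num)).le_iff_le.1
      (key.trans (le_of_eq ?_))
    rw [mul_div_cancel₀ _ (by norm_num), ENNReal.ofReal_inv_of_pos (by positivity),
      ENNReal.ofReal_pow (by norm_num), ← pow_mul, mul_comm l 4, pow_mul, h16, ENNReal.inv_pow]
    norm_num
  set T : (Fin (k + 1) → Fin s → Fin m × unitInterval) × (Fin (k + 1) → Fin n → ℝ) → ℝ≥0∞ :=
    fun q => ∑ i, scaleCount c (d q.1 q.2 i) with hT
  have hTm : Measurable T :=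
    Finset.measurable_sum _ fun i _ => (measurable_scaleCount c).comp (hdm i)
  -- The mean count in a row is the sum of the probabilities `hprob`, at most `∑ 2 ^ (-l) = 2`.
  have hTi : ∫⁻ z, T (e z) ∂(Measure.pi fun _ : Fin (k + 1) => μ) ≤ (k + 1 : ℕ) * 2 := by
    have hms : ∀ i, Measurable fun z => scaleCount c (d (e z).1 (e z).2 i) := fun i =>
      (measurable_scaleCount c).comp ((hdm i).comp e.measurable)
    rw [hT, lintegral_finsetSum _ fun i _ => hms i]
    refine (Finset.sum_le_sum (g := fun _ => 2) fun i _ => ?_).trans (by simp)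
    have hSm : ∀ l : ℕ, MeasurableSet {z | d (e z).1 (e z).2 i ≤ c / 256 ^ l} := fun l =>
      measurableSet_le ((hdm i).comp e.measurable) measurable_const
    calc ∫⁻ z, scaleCount c (d (e z).1 (e z).2 i) ∂(Measure.pi fun _ : Fin (k + 1) => μ)
        = ∑' l : ℕ, (Measure.pi fun _ : Fin (k + 1) => μ)
            {z | d (e z).1 (e z).2 i ≤ c / 256 ^ l} := by
          rw [← tsum_congr fun l => lintegral_indicator_one (hSm l),
            ← lintegral_tsum fun l => (measurable_one.indicator (hSm l)).aemeasurable]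
          rfl
      _ ≤ ∑' l : ℕ, 2⁻¹ ^ l := ENNReal.tsum_le_tsum fun l => hprob i l
      _ = 2 := by rw [ENNReal.tsum_geometric, ENNReal.one_sub_inv_two, inv_inv]
  have hGm : MeasurableSet {q | T q < 4 * (k + 1 : ℕ)} := measurableSet_lt hTm measurable_const
  have hG : 1 / 2 ≤ ((Measure.pi fun _ : Fin (k + 1) => blockPrior s m).prod
      (Measure.pi fun _ : Fin (k + 1) => N)) {q | T q < 4 * (k + 1 : ℕ)} := by
    have hT2 : ∫⁻ q, T q ∂((Measure.pi fun _ : Fin (k + 1) => blockPrior s m).prod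
        (Measure.pi fun _ : Fin (k + 1) => N)) ≤ (k + 1 : ℕ) * 2 := by
      rwa [← hmp.lintegral_comp hTm]
    -- Markov at twice the bound on the mean.
    have hmk := (meas_ge_le_lintegral_div hTm.aemeasurable
      (μ := (Measure.pi fun _ : Fin (k + 1) => blockPrior s m).prod
        (Measure.pi fun _ : Fin (k + 1) => N)) (ε := 4 * (k + 1 : ℕ)) (by simp) (by finiteness)).trans
      (ENNReal.div_le_div_right hT2 _)
    have hhalf : ((k + 1 : ℕ) : ℝ≥0∞) * 2 / (4 * (k + 1 : ℕ)) = 1 / 2 := by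
      rw [mul_comm, ENNReal.mul_div_mul_right _ _ (by simp) (by finiteness),
        show (4 : ℝ≥0∞) = 2 * 2 by norm_num]
      nth_rw 1 [← mul_one (2 : ℝ≥0∞)]
      rw [ENNReal.mul_div_mul_left _ _ (by simp) (by simp)]
    rw [hhalf] at hmk
    have hcompl : {q | T q < 4 * (k + 1 : ℕ)}ᶜ = {q | 4 * (k + 1 : ℕ) ≤ T q} := by
      ext q; simp
    have hadd := measure_add_measure_compl (μ := (Measure.pi fun _ : Fin (k + 1) =>
      blockPrior s m).prod (Measure.pi fun _ : Fin (k + 1) => N)) hGm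
    rw [hcompl, measure_univ] at hadd
    refine ENNReal.le_of_add_le_add_right (a := 1 / 2) (by simp) ?_
    rw [ENNReal.add_halves]
    exact hadd.symm.le.trans (add_le_add_right hmk _)
  rw [Measure.prod_apply hGm] at hG
  have hfin : ∫⁻ θ, (Measure.pi fun _ : Fin (k + 1) => N)
      (Prod.mk θ ⁻¹' {q | T q < 4 * (k + 1 : ℕ)})
      ∂(Measure.pi fun _ : Fin (k + 1) => blockPrior s m) ≠ ⊤ := by
    rw [← Measure.prod_apply hGm]
    exact measure_ne_top _ _
  -- Some parameter does at least as well as the prior average.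
  obtain ⟨θ, hθ⟩ := exists_lintegral_le hfin
  exact ⟨fun i => a (θ i), fun i => blockVector_mem_sparseBall emb τ (θ i), hG.trans hθ⟩

end

/-! ### Choice of constants and conclusion -/

/-- With `m` the integer quotient, `e n / s ≤ 3 (m + 1) ≤ m ^ 4` since `m ≥ 2`. The fourth root
leaves room for the rounding and for the factor `e`. -/
theorem exp_log_div_four_le {n s : ℕ} (hs : 1 ≤ s) (hsn : (s : ℝ) ≤ (n : ℝ) / 2) :
    Real.exp (Real.log (Real.exp 1 * n / s) / 4) ≤ (n / s : ℕ) := by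
  have hs0 : (0 : ℝ) < s := by exact_mod_cast hs
  have h2 : 2 ≤ n / s := by
    rw [Nat.le_div_iff_mul_le hs]
    have : (2 * s : ℝ) ≤ n := by linarith
    exact_mod_cast this
  have hn0 : (0 : ℝ) < n := by linarith
  have h2' : (2 : ℝ) ≤ (n / s : ℕ) := by exact_mod_cast h2
  have hlt : (n : ℝ) < s * ((n / s : ℕ) + 1) := by
    exact_mod_cast Nat.lt_mul_div_succ n hs
  set m : ℝ := ((n / s : ℕ) : ℝ)
  have h1 : Real.exp 1 * n / s ≤ m ^ 4 := by
    rw [div_le_iff₀ hs0]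
    have he := Real.exp_one_lt_d9
    calc Real.exp 1 * n ≤ 3 * (s * (m + 1)) := by gcongr; linarith
      _ ≤ m ^ 4 * s := by
        have : 3 * (m + 1) ≤ m ^ 4 := by nlinarith [sq_nonneg (m ^ 2 - 4), sq_nonneg (m - 2)]
        nlinarith
  calc _ ≤ Real.exp (Real.log (m ^ 4) / 4) := by gcongr
    _ = m := by
      rw [Real.log_pow]
      push_cast
      rw [mul_div_cancel_left₀ _ (by norm_num), Real.exp_log (by linarith)]

/-- For each estimator there is a matrix at which the loss exceeds the rate with probability at
least one half. -/
theorem exists_rowSparse_sqError_ge {n₁ n₂ s : ℕ} {p σ : ℝ} (hn₁ : n₁ ≠ 0) (hp : 0 < p)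
    (hσ : 0 < σ) (hs : 1 ≤ s) (hsn : (s : ℝ) ≤ (n₂ : ℝ) / 2) {Ω : Type*} [MeasurableSpace Ω]
    (P : Measure Ω) [IsProbabilityMeasure P] {ξ : Fin n₁ → Fin n₂ → Ω → ℝ}
    (hξ : IsGaussianNoise P σ ξ) (est : Estimator n₁ n₂) :
    ∃ A ∈ rowSparse n₁ n₂ s, ∃ S : Set Ω, NullMeasurableSet S P ∧ 1 / 2 ≤ P S ∧
      ∀ ω ∈ S, 2⁻¹ ^ 44 * lowerRate n₁ n₂ s p σ ≤ sqError p ξ est A ω := by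
  have hs0 : (0 : ℝ) < s := by exact_mod_cast hs
  set ℓ := Real.log (Real.exp 1 * n₂ / s) with hℓ
  have hℓ0 : 0 < ℓ := by
    refine Real.log_pos ?_
    rw [lt_div_iff₀ hs0]
    have := Real.add_one_lt_exp (one_ne_zero)
    nlinarith
  -- Chosen so that `exp(4τ² / σ²) ^ 2 = exp(ℓ / 4)`, which is at most `m`.
  set τ := σ * √(ℓ / 32) with hτd
  have hτ : 0 < τ := by positivity
  have hτ2 : τ ^ 2 = σ ^ 2 * (ℓ / 32) := by rw [hτd, mul_pow, Real.sq_sqrt (by positivity)]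
  have hv : (σ ^ 2).toNNReal ≠ 0 := by simpa using hσ.ne'
  set m := n₂ / s with hm
  have hme := exp_log_div_four_le hs hsn
  have : NeZero m := ⟨fun h => by
    rw [← hm, h, Nat.cast_zero] at hme
    exact absurd (Real.exp_pos _) (not_lt.2 hme)⟩
  have hexp : Real.exp (4 * τ ^ 2 / ((σ ^ 2).toNNReal : ℝ)) ^ 2 ≤ m := by
    rw [← Real.exp_nat_mul, Real.coe_toNNReal _ (sq_nonneg σ), hτ2]
    refine le_trans (le_of_eq ?_) hme
    congr 1
    push_cast
    field_simp
    ring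
  have hle : s * m ≤ n₂ := Nat.mul_div_le n₂ s
  obtain ⟨f, hf, hfe⟩ : ∃ f : (Fin n₁ → Fin n₂ → ℝ) → Fin n₁ → Fin n₂ → ℝ,
      Measurable f ∧ f = est.1 := ⟨est.1, est.2, rfl⟩
  obtain ⟨A, hA, hAP⟩ := exists_rows_scaleCount_lt hn₁
    (emb := fun q : Fin s × Fin m => Fin.castLE hle (finProdFinEquiv q))
    ((Fin.castLE_injective hle).comp finProdFinEquiv.injective) (by omega) hv hτ hexp hf
  obtain ⟨hmeas, hmap⟩ := map_noise_eq hξ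
  set G : Set (Fin n₁ → Fin n₂ → ℝ) := {E | ∑ i, scaleCount (τ ^ 2 * s / 128)
    (∑ j, (f (A + E) i j - A i j) ^ 2) < 4 * n₁} with hG
  have hGm : MeasurableSet G := by
    refine measurableSet_lt (Finset.measurable_sum _ fun i _ =>
      (measurable_scaleCount _).comp (Finset.measurable_sum _ fun j _ => ?_)) measurable_const
    exact (((measurable_pi_apply j).comp ((measurable_pi_apply i).comp
      (hf.comp (measurable_const.add measurable_id)))).sub measurable_const).pow_const 2
  -- The noise is only almost everywhere measurable, so the event is only null-measurable.
  refine ⟨A, hA, (fun ω i j => ξ i j ω) ⁻¹' G, hmeas.nullMeasurableSet_preimage hGm, ?_, ?_⟩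
  · rw [← Measure.map_apply_of_aemeasurable hmeas hGm, hmap]
    exact hAP
  · intro ω hω
    have h := mixedNorm_sq_ge_of_scaleCount hn₁ hp (c := τ ^ 2 * s / 128) (by positivity)
      (Matrix.of (f (A + fun i j => ξ i j ω)) - Matrix.of A) hω
    rw [hfe] at h
    change _ ≤ sqError p ξ est A ω at h
    -- The constant collects `32 · 128 · 16 ^ 8 = 2 ^ 44`.
    refine le_trans (le_of_eq ?_) h
    rw [hτ2, lowerRate, ← hℓ]
    ring

theorem theorem1 :
    ∃ β C C' : ℝ, 0 < β ∧ β < 1 ∧ 0 < C ∧ 0 < C' ∧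
      ∀ (n₁ n₂ s : ℕ) (p σ : ℝ), 2 ≤ n₁ → 2 ≤ n₂ → 0 < p → 0 < σ →
        1 ≤ s → (s : ℝ) ≤ (n₂ : ℝ) / 2 →
      ∀ (Ω : Type*) [MeasurableSpace Ω] (P : Measure Ω) [IsProbabilityMeasure P]
        (ξ : Fin n₁ → Fin n₂ → Ω → ℝ), IsGaussianNoise P σ ξ →
        (ENNReal.ofReal β ≤
            ⨅ est : Estimator n₁ n₂, ⨆ A ∈ rowSparse n₁ n₂ s,
              P {ω | C * lowerRate n₁ n₂ s p σ ≤ sqError p ξ est A ω}) ∧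
          (ENNReal.ofReal (C' * lowerRate n₁ n₂ s p σ) ≤
            ⨅ est : Estimator n₁ n₂, ⨆ A ∈ rowSparse n₁ n₂ s,
              ∫⁻ ω, ENNReal.ofReal (sqError p ξ est A ω) ∂P) := by
  refine ⟨1 / 2, 2⁻¹ ^ 44, 2⁻¹ ^ 44 * (1 / 2), by norm_num, by norm_num, by norm_num, by norm_num,
    ?_⟩
  intro n₁ n₂ s p σ hn₁ _ hp hσ hs hsn Ω _ P _ ξ hξ
  have hhalf : ENNReal.ofReal (1 / 2) = 1 / 2 := by
    rw [ENNReal.ofReal_div_of_pos (by norm_num)]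
    simp
  refine ⟨le_iInf fun est => ?_, le_iInf fun est => ?_⟩ <;>
    obtain ⟨A, hA, S, hSm, hS, hSω⟩ :=
      exists_rowSparse_sqError_ge (by omega) hp hσ hs hsn P hξ est
  · refine le_trans ?_ (le_iSup₂ A hA)
    rw [hhalf]
    exact hS.trans (measure_mono hSω)
  · refine le_trans ?_ (le_iSup₂ A hA)
    rw [mul_right_comm, ENNReal.ofReal_mul' (by norm_num), hhalf]
    calc _ ≤ ENNReal.ofReal (2⁻¹ ^ 44 * lowerRate n₁ n₂ s p σ) * P S := by gcongr
      _ = ∫⁻ ω, S.indicator (fun _ => ENNReal.ofReal (2⁻¹ ^ 44 * lowerRate n₁ n₂ s p σ)) ω ∂P :=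
        (lintegral_indicator_const₀ hSm _).symm
      _ ≤ _ := by
        refine lintegral_mono fun ω => ?_
        by_cases hω : ω ∈ S
        · rw [Set.indicator_of_mem hω]
          exact ENNReal.ofReal_le_ofReal (hSω ω hω)
        · rw [Set.indicator_of_notMem hω]
          exact zero_le
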